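/- Let $n \ge 4$ be an integer that is not prime, and let $\Gamma(\mathbb{Z}_n)$ be the zero divisor graph of the ring $\mathbb{Z}_n$ of integers modulo $n$: its vertices are the nonzero $x \in \mathbb{Z}_n$ for which $xy = 0$ for some nonzero $y \in \mathbb{Z}_n$, and two distinct vertices $x, y$ are adjacent if and only if $xy = 0$. For a finite simple graph $G$ with at least two vertices, let the algebraic connectivity $\mu(G)$ be the second smallest eigenvalue, counted with multiplicity, of the Laplacian matrix $L(G) = D(G) - A(G)$, where $D(G)$ is the diagonal matrix of vertex degrees and $A(G)$ is the adjacency matrix; $\mu(G)$ is undefined if $G$ has only one vertex. Let the vertex connectivity $\kappa(G)$ be the minimum number of vertices whose removal leaves an induced subgraph that is disconnected or has exactly one vertex. Then $\mu(\Gamma(\mathbb{Z}_n))$ is defined (that is, $\Gamma(\mathbb{Z}_n)$ has at least two vertices) and $$\mu(\Gamma(\mathbb{Z}_n)) = \kappa(\Gamma(\mathbb{Z}_n))$$ if and only if $n = pq$ for two distinct primes $p$ and $q$, or $n = p^t$ for some prime $p$ and some integer $t \ge 3$. -/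

import Mathlib

/-- The (nonzero) zero divisors of a commutative ring: the nonzero `x` for which there is a
nonzero `y` with `x * y = 0`. -/
abbrev ZeroDivisor (R : Type*) [CommRing R] : Type _ :=
  {x : R // x ≠ 0 ∧ ∃ y : R, y ≠ 0 ∧ x * y = 0}

noncomputable instance ZeroDivisor.instFintype (R : Type*) [CommRing R] [Finite R] :
    Fintype (ZeroDivisor R) := Fintype.ofFinite _

/-- The zero divisor graph of a commutative ring: its vertices are the nonzero zero divisors, and
two distinct vertices are adjacent iff their product is zero. -/
def zeroDivisorGraph (R : Type*) [CommRing R] : SimpleGraph (ZeroDivisor R) where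
  Adj x y := x ≠ y ∧ (x : R) * (y : R) = 0
  symm := ⟨fun _ _ h => ⟨h.1.symm, by rw [mul_comm]; exact h.2⟩⟩
  loopless := ⟨fun _ h => h.1 rfl⟩

namespace SimpleGraph

open Classical in
/-- The algebraic connectivity of a finite graph with at least two vertices: the second smallest
eigenvalue, counted with multiplicity, of its Laplacian matrix. (`eigenvalues₀` lists the
eigenvalues with multiplicity in decreasing order, so the second smallest one stands at
position `card V - 2`.) A graph with at most one vertex has no second smallest eigenvalue. -/
noncomputable def algebraicConnectivity {V : Type*} [Fintype V] (G : SimpleGraph V)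
    (h : 2 ≤ Fintype.card V) : ℝ :=
  (G.isHermitian_lapMatrix ℝ).eigenvalues₀ ⟨Fintype.card V - 2, by omega⟩

/-- The vertex connectivity of a finite graph: the least number of vertices whose removal leaves
an induced subgraph that is disconnected or has exactly one vertex. (A graph without vertices is
`Preconnected`, so it does not count as disconnected.) -/
noncomputable def vertexConnectivity {V : Type*} [Fintype V] (G : SimpleGraph V) : ℕ :=
  sInf {k : ℕ | ∃ S : Finset V, S.card = k ∧
    (¬ (G.induce {v | v ∉ S}).Preconnected ∨ Nat.card {v // v ∉ S} = 1)}

end SimpleGraph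

/-! Rayleigh quotients compare `μ` with cuts. If deleting `S` disconnects the graph, a test vector
supported on the remaining pieces gives `μ ≤ #S`, and equality forces `S` to be completely joined to
its complement. Conversely, a cut completely joined to the rest and holding at most half of the
vertices gives `κ ≤ #S ≤ μ`, so `μ = κ`.

For `n = p * m` with `m = q > p` or `m = p ^ (t - 1)`, the multiples of `m` are such a cut, since
every neighbour of `p` is a multiple of `m`. If `n ≠ p * q` has distinct prime divisors `p` and `q`,
non-adjacency links all vertices through `p` and `q`, so no proper nonempty set is joined to the
rest; the graph is connected, so the empty set is no cut, and `μ ≠ κ`. For `n = p ^ 2` the graph is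
complete and `μ` exceeds `κ`. -/

open Finset Matrix

/-! ### Spectral expansion of real quadratic forms. -/

namespace Matrix.IsHermitian

variable {V : Type*} [Fintype V] [DecidableEq V] {A : Matrix V V ℝ} (hA : A.IsHermitian)

/-- Parseval's identity for the eigenvector basis of a real symmetric matrix. -/
theorem sum_eigenvectorBasis_dotProduct_mul (x y : V → ℝ) :
    ∑ j, (⇑(hA.eigenvectorBasis j) ⬝ᵥ x) * (⇑(hA.eigenvectorBasis j) ⬝ᵥ y) = x ⬝ᵥ y := by
  have h := hA.eigenvectorBasis.sum_inner_mul_inner (WithLp.toLp 2 x) (WithLp.toLp 2 y)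
  simp only [EuclideanSpace.inner_eq_star_dotProduct, star_trivial] at h
  rw [dotProduct_comm x y, ← h]
  exact Finset.sum_congr rfl fun j _ => by rw [dotProduct_comm y]

theorem eigenvectorBasis_dotProduct_mulVec (j : V) (x : V → ℝ) :
    ⇑(hA.eigenvectorBasis j) ⬝ᵥ (A *ᵥ x) =
      hA.eigenvalues j * (⇑(hA.eigenvectorBasis j) ⬝ᵥ x) := by
  have hT : Aᵀ = A := by simpa [conjTranspose_eq_transpose_of_trivial] using hA.eq
  rw [dotProduct_mulVec, ← mulVec_transpose, hT, hA.mulVec_eigenvectorBasis, smul_dotProduct,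
    smul_eq_mul]

theorem dotProduct_mulVec_eq_sum (x : V → ℝ) :
    x ⬝ᵥ (A *ᵥ x) = ∑ j, hA.eigenvalues j * (⇑(hA.eigenvectorBasis j) ⬝ᵥ x) ^ 2 := by
  rw [← hA.sum_eigenvectorBasis_dotProduct_mul]
  refine Finset.sum_congr rfl fun j _ => ?_
  rw [hA.eigenvectorBasis_dotProduct_mulVec]
  ring

theorem dotProduct_self_eq_sum (x : V → ℝ) :
    x ⬝ᵥ x = ∑ j, (⇑(hA.eigenvectorBasis j) ⬝ᵥ x) ^ 2 := by
  rw [← hA.sum_eigenvectorBasis_dotProduct_mul]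
  exact Finset.sum_congr rfl fun j _ => by ring

theorem eigenvectorBasis_dotProduct (i j : V) :
    ⇑(hA.eigenvectorBasis i) ⬝ᵥ ⇑(hA.eigenvectorBasis j) = if i = j then 1 else 0 := by
  have h := orthonormal_iff_ite.1 hA.eigenvectorBasis.orthonormal j i
  rw [EuclideanSpace.inner_eq_star_dotProduct, star_trivial] at h
  rw [h]
  simp only [eq_comm]

/-- The second smallest eigenvalue is `eigenvalues m`, where every index other than `l` has an
eigenvalue at least as large, and `l` one at most as large. -/
theorem exists_eigenvalues_eq_second_smallest (h : 2 ≤ Fintype.card V) :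
    ∃ l m : V, l ≠ m ∧ hA.eigenvalues m = hA.eigenvalues₀ ⟨Fintype.card V - 2, by omega⟩ ∧
      hA.eigenvalues l ≤ hA.eigenvalues m ∧
      ∀ j, j ≠ l → hA.eigenvalues m ≤ hA.eigenvalues j := by
  set e : Fin (Fintype.card V) ≃ V := Fintype.equivOfCardEq (Fintype.card_fin _) with he
  have hev : ∀ i, hA.eigenvalues (e i) = hA.eigenvalues₀ i := fun i => by
    simp [eigenvalues, he]
  refine ⟨e ⟨Fintype.card V - 1, by omega⟩, e ⟨Fintype.card V - 2, by omega⟩, ?_, hev _, ?_, ?_⟩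
  · rw [Ne, e.apply_eq_iff_eq, Fin.mk.injEq]
    omega
  · rw [hev, hev]
    exact hA.eigenvalues₀_antitone (Fin.mk_le_mk.2 (by omega))
  · intro j hj
    obtain ⟨i, rfl⟩ := e.surjective j
    rw [hev, hev]
    refine hA.eigenvalues₀_antitone ?_
    have hi : (i : ℕ) ≠ Fintype.card V - 1 := fun h' => hj (congrArg e (Fin.ext h'))
    rw [Fin.le_def]
    have := i.2
    simp only
    omega

end Matrix.IsHermitian

/-! ### Variational description of the algebraic connectivity. -/

namespace SimpleGraph

variable {V : Type*} [Fintype V] (G : SimpleGraph V)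

open Classical in
theorem dotProduct_lapMatrix_mulVec (x : V → ℝ) :
    x ⬝ᵥ (G.lapMatrix ℝ *ᵥ x) =
      (∑ i : V, ∑ j : V, if G.Adj i j then (x i - x j) ^ 2 else 0) / 2 := by
  rw [← toLinearMap₂'_apply', lapMatrix_toLinearMap₂']

open Classical in
/-- The algebraic connectivity bounds the Rayleigh quotient from below on vectors orthogonal to
the constants. -/
theorem algebraicConnectivity_mul_le (h : 2 ≤ Fintype.card V) {x : V → ℝ} (hx : ∑ v, x v = 0) :
    G.algebraicConnectivity h * ∑ v, x v ^ 2 ≤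
      (∑ i : V, ∑ j : V, if G.Adj i j then (x i - x j) ^ 2 else 0) / 2 := by
  have hQ : ∑ v, x v ^ 2 = x ⬝ᵥ x := Finset.sum_congr rfl fun v _ => sq (x v)
  rw [← dotProduct_lapMatrix_mulVec, hQ]
  set hA := G.isHermitian_lapMatrix ℝ with hAdef
  obtain ⟨l, m, -, hm, -, hmin⟩ := hA.exists_eigenvalues_eq_second_smallest h
  have hμ : G.algebraicConnectivity h = hA.eigenvalues m := hm.symm
  rw [hμ]
  rcases le_or_gt (hA.eigenvalues m) 0 with h0 | h0
  · refine (mul_nonpos_of_nonpos_of_nonneg h0 ?_).trans ?_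
    · rw [← hQ]; positivity
    · rw [dotProduct_lapMatrix_mulVec]
      positivity
  · set u : V → V → ℝ := fun j => ⇑(hA.eigenvectorBasis j) with hu
    -- The constants lie in the kernel, hence are orthogonal to every eigenvector with positive
    -- eigenvalue. So only `u l` can carry them, and `x`, orthogonal to the constants, is orthogonal
    -- to `u l`.
    have hone : ∀ j, j ≠ l → u j ⬝ᵥ (fun _ => (1 : ℝ)) = 0 := fun j hj => by
      have h1 := hA.eigenvectorBasis_dotProduct_mulVec j (fun _ => 1)
      rw [lapMatrix_mulVec_const_eq_zero, dotProduct_zero] at h1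
      exact (mul_eq_zero.1 h1.symm).resolve_left (h0.trans_le (hmin j hj)).ne'
    have hl : u l ⬝ᵥ x = 0 := by
      have h1 := hA.sum_eigenvectorBasis_dotProduct_mul (fun _ => 1) x
      have h2 := hA.dotProduct_self_eq_sum (fun _ => 1)
      rw [Finset.sum_eq_single l (fun j _ hj => by rw [hone j hj, zero_mul]) (by simp)] at h1
      rw [Finset.sum_eq_single l (fun j _ hj => by rw [hone j hj]; ring) (by simp)] at h2
      have h3 : (fun _ : V => (1 : ℝ)) ⬝ᵥ x = 0 := by simpa [dotProduct] using hx
      rw [h3] at h1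
      refine (mul_eq_zero.1 h1).resolve_left fun h4 => ?_
      rw [h4] at h2
      simp [dotProduct] at h2
      omega
    rw [hA.dotProduct_mulVec_eq_sum, hA.dotProduct_self_eq_sum, Finset.mul_sum]
    refine Finset.sum_le_sum fun j _ => ?_
    by_cases hj : j = l
    · subst hj
      change _ * (u j ⬝ᵥ x) ^ 2 ≤ _ * (u j ⬝ᵥ x) ^ 2
      rw [hl]
      simp
    · exact mul_le_mul_of_nonneg_right (hmin j hj) (sq_nonneg _)

open Classical in
/-- A lower bound of the Rayleigh quotient on vectors orthogonal to the constants is a lower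
bound of the algebraic connectivity. -/
theorem le_algebraicConnectivity (h : 2 ≤ Fintype.card V) {c : ℝ}
    (hc : ∀ x : V → ℝ, ∑ v, x v = 0 → c * ∑ v, x v ^ 2 ≤
      (∑ i : V, ∑ j : V, if G.Adj i j then (x i - x j) ^ 2 else 0) / 2) :
    c ≤ G.algebraicConnectivity h := by
  set hA := G.isHermitian_lapMatrix ℝ with hAdef
  obtain ⟨l, m, hlm, hm, hle, -⟩ := hA.exists_eigenvalues_eq_second_smallest h
  have hμ : G.algebraicConnectivity h = hA.eigenvalues m := hm.symm
  rw [hμ]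
  set u : V → V → ℝ := fun j => ⇑(hA.eigenvectorBasis j) with hu
  -- The plane spanned by the two lowest eigenvectors meets the hyperplane of sum zero nontrivially.
  obtain ⟨α, β, hαβ, hort⟩ : ∃ α β : ℝ, 0 < α ^ 2 + β ^ 2 ∧
      α * ∑ v, u l v + β * ∑ v, u m v = 0 := by
    by_cases h1 : ∑ v, u l v = 0
    · exact ⟨1, 0, by norm_num, by rw [h1]; ring⟩
    · exact ⟨-∑ v, u m v, ∑ v, u l v, by positivity, by ring⟩
  set x : V → ℝ := α • u l + β • u m with hxdef
  have hx : ∑ v, x v = 0 := by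
    simpa [hxdef, Finset.sum_add_distrib, ← Finset.mul_sum] using hort
  have hux : ∀ j, u j ⬝ᵥ x = α * (if j = l then 1 else 0) + β * (if j = m then 1 else 0) := by
    intro j
    rw [hxdef, dotProduct_add, dotProduct_smul, dotProduct_smul]
    rw [hA.eigenvectorBasis_dotProduct, hA.eigenvectorBasis_dotProduct]
    simp
  have hsum : ∀ f : V → ℝ, ∑ j, f j * (u j ⬝ᵥ x) ^ 2 = f l * α ^ 2 + f m * β ^ 2 := by
    intro f
    rw [Finset.sum_eq_add l m hlm]
    · rw [hux, hux]
      simp [hlm, hlm.symm]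
    · rintro j - ⟨h1, h2⟩
      rw [hux]
      simp [h1, h2]
    · simp
    · simp
  have hQ : ∑ v, x v ^ 2 = α ^ 2 + β ^ 2 := by
    have h1 : ∑ v, x v ^ 2 = x ⬝ᵥ x := Finset.sum_congr rfl fun v _ => sq (x v)
    rw [h1, hA.dotProduct_self_eq_sum]
    simpa using hsum fun _ => 1
  have hE := hc x hx
  rw [← dotProduct_lapMatrix_mulVec, hA.dotProduct_mulVec_eq_sum, hQ] at hE
  have h2 := hsum hA.eigenvalues
  rw [h2] at hE
  have h3 : hA.eigenvalues l * α ^ 2 ≤ hA.eigenvalues m * α ^ 2 :=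
    mul_le_mul_of_nonneg_right hle (sq_nonneg α)
  exact le_of_mul_le_mul_right (by linarith) hαβ

end SimpleGraph

/-! ### Vertex cuts and joins. -/

namespace SimpleGraph

variable {V : Type*} [Fintype V] (G : SimpleGraph V)

/-- If removing `S` disconnects `G`, then some vector orthogonal to the constants vanishes exactly
on `S` and is constant along the edges that avoid `S`. -/
theorem exists_vector_of_not_preconnected {S : Finset V}
    (hS : ¬ (G.induce {v | v ∉ S}).Preconnected) :
    ∃ x : V → ℝ, ∑ v, x v = 0 ∧ (∀ v, x v = 0 ↔ v ∈ S) ∧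
      ∀ i j, i ∉ S → j ∉ S → G.Adj i j → x i = x j := by
  classical
  simp only [Preconnected, not_forall] at hS
  obtain ⟨u, w, huw⟩ := hS
  set A : Finset V := univ.filter fun v => ∃ h : v ∉ S, (G.induce {v | v ∉ S}).Reachable u ⟨v, h⟩
    with hA
  set B : Finset V := univ.filter fun v => v ∉ S ∧ v ∉ A with hB
  have memA : ∀ v, v ∈ A ↔ ∃ h : v ∉ S, (G.induce {v | v ∉ S}).Reachable u ⟨v, h⟩ := fun v => by
    simp [hA]
  have memB : ∀ v, v ∈ B ↔ v ∉ S ∧ v ∉ A := fun v => by simp [hB]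
  have hAS : ∀ v ∈ A, v ∉ S := fun v hv => ((memA v).1 hv).1
  have hu : (u : V) ∈ A := (memA _).2 ⟨u.2, Reachable.refl _⟩
  have hw : (w : V) ∈ B := (memB _).2 ⟨w.2, fun h => huw ((memA _).1 h).2⟩
  have ha : (0 : ℝ) < #A := by exact_mod_cast card_pos.2 ⟨_, hu⟩
  have hb : (0 : ℝ) < #B := by exact_mod_cast card_pos.2 ⟨_, hw⟩
  have step : ∀ i j, j ∉ S → G.Adj i j → i ∈ A → j ∈ A := fun i j hj hij hi => by
    obtain ⟨hiS, hr⟩ := (memA i).1 hi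
    refine (memA j).2 ⟨hj, hr.trans (Adj.reachable ?_)⟩
    simpa using hij
  -- The value `#B` on the component `A` and `-#A` on the remaining part `B` balance to sum zero.
  refine ⟨fun v => (if v ∈ A then (#B : ℝ) else 0) - (if v ∈ B then (#A : ℝ) else 0), ?_, ?_, ?_⟩
  · rw [Finset.sum_sub_distrib, Finset.sum_ite_mem, Finset.sum_ite_mem]
    simp [mul_comm]
  · intro v
    by_cases hvS : v ∈ S
    · have h1 : v ∉ A := fun h => hAS v h hvS
      have h2 : v ∉ B := fun h => ((memB v).1 h).1 hvS
      simp [h1, h2, hvS]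
    · by_cases hvA : v ∈ A
      · have h2 : v ∉ B := fun h => ((memB v).1 h).2 hvA
        simp only [hvA, h2, hvS, if_true, if_false, sub_zero, iff_false]
        exact hb.ne'
      · have h2 : v ∈ B := (memB v).2 ⟨hvS, hvA⟩
        simp only [hvA, h2, hvS, if_true, if_false, zero_sub, iff_false, neg_eq_zero]
        exact ha.ne'
  · intro i j hi hj hij
    have h1 : i ∈ A ↔ j ∈ A := ⟨step i j hj hij, step j i hi hij.symm⟩
    have h2 : i ∈ B ↔ j ∈ B := by rw [memB, memB, h1]; simp [hi, hj]
    simp only [h1, h2]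

/-- Removing fewer than `μ` vertices does not disconnect a graph, and if removing exactly `μ`
vertices does, these are adjacent to all the others. -/
theorem algebraicConnectivity_le_card_of_not_preconnected (h : 2 ≤ Fintype.card V) {S : Finset V}
    (hS : ¬ (G.induce {v | v ∉ S}).Preconnected) :
    G.algebraicConnectivity h ≤ #S ∧
      (G.algebraicConnectivity h = #S → ∀ i ∈ S, ∀ j ∉ S, G.Adj i j) := by
  classical
  obtain ⟨x, hx0, hxS, hxe⟩ := G.exists_vector_of_not_preconnected hS
  have hQ : 0 < ∑ v, x v ^ 2 := by
    simp only [Preconnected, not_forall] at hS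
    obtain ⟨u, -⟩ := hS
    have hu : x u ≠ 0 := fun h0 => u.2 ((hxS u).1 h0)
    exact Finset.sum_pos' (fun _ _ => sq_nonneg _) ⟨u, mem_univ _, by positivity⟩
  have hμ := G.algebraicConnectivity_mul_le h hx0
  -- Only edges between `S` and its complement carry energy. The bound is strict at any non-adjacent
  -- pair across the cut, which settles the equality case.
  have hpt : ∀ i j, (if G.Adj i j then (x i - x j) ^ 2 else 0) ≤
      (if i ∈ S then x j ^ 2 else 0) + (if j ∈ S then x i ^ 2 else 0) := by
    intro i j
    have hpos : 0 ≤ (if i ∈ S then x j ^ 2 else 0) + (if j ∈ S then x i ^ 2 else 0) := by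
      positivity
    by_cases hij : G.Adj i j
    · rw [if_pos hij]
      by_cases hi : i ∈ S
      · rw [(hxS i).2 hi]
        simp [hi]
      · by_cases hj : j ∈ S
        · rw [(hxS j).2 hj]
          simp [hi, hj]
        · rw [hxe i j hi hj hij]
          simp [hi, hj]
    · rwa [if_neg hij]
  have hsum : ∑ i, ∑ j, ((if i ∈ S then x j ^ 2 else 0) + (if j ∈ S then x i ^ 2 else 0)) =
      2 * (#S * ∑ v, x v ^ 2) := by
    simp only [Finset.sum_add_distrib]
    rw [Finset.sum_comm (f := fun i j => if i ∈ S then x j ^ 2 else 0)]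
    simp only [Finset.sum_ite_mem, Finset.sum_const, univ_inter, nsmul_eq_mul, ← Finset.mul_sum]
    ring
  constructor
  · refine le_of_mul_le_mul_right ?_ hQ
    have hE := Finset.sum_le_sum fun i (_ : i ∈ univ) =>
      Finset.sum_le_sum fun j (_ : j ∈ univ) => hpt i j
    rw [hsum] at hE
    linarith
  · intro heq i hi j hj
    by_contra hij
    have hxj : x j ≠ 0 := fun h0 => hj ((hxS j).1 h0)
    have hE := Finset.sum_lt_sum
      (fun i (_ : i ∈ univ) => Finset.sum_le_sum fun j (_ : j ∈ univ) => hpt i j)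
      ⟨i, mem_univ _, Finset.sum_lt_sum (fun j (_ : j ∈ univ) => hpt i j) ⟨j, mem_univ _, by
        rw [if_neg hij, if_pos hi, if_neg hj, add_zero]
        positivity⟩⟩
    rw [hsum] at hE
    rw [heq] at hμ
    linarith

/-- A minimum cut of a graph that is not complete leaves a disconnected graph. -/
theorem exists_card_eq_vertexConnectivity {u w : V} (hne : u ≠ w) (huw : ¬ G.Adj u w) :
    ∃ S : Finset V, #S = G.vertexConnectivity ∧ ¬ (G.induce {v | v ∉ S}).Preconnected := by
  classical
  set K := {k : ℕ | ∃ S : Finset V, #S = k ∧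
    (¬ (G.induce {v | v ∉ S}).Preconnected ∨ Nat.card {v // v ∉ S} = 1)} with hK
  -- Keep only the two non-adjacent vertices. This bound also rules out a minimum that leaves a
  -- single vertex, as that needs `card V - 1` deletions.
  have hmem : Fintype.card V - 2 ∈ K := by
    refine ⟨univ \ {u, w}, ?_, Or.inl fun hp => ?_⟩
    · rw [card_sdiff_of_subset (subset_univ _), card_pair hne, card_univ]
    · obtain ⟨p⟩ := hp ⟨u, by simp⟩ ⟨w, by simp⟩
      cases p with
      | nil => exact hne rfl
      | @cons _ v _ hv q =>
        have hv' : G.Adj u v := by simpa using hv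
        have h2 : (v : V) = u ∨ (v : V) = w := or_iff_not_imp_left.2 (by simpa using v.2)
        rcases h2 with h2 | h2
        · exact G.loopless.irrefl u (by rwa [h2] at hv')
        · exact huw (by rwa [h2] at hv')
  obtain ⟨S, hcard, hS⟩ := Nat.sInf_mem ⟨_, hmem⟩
  refine ⟨S, hcard, hS.resolve_right fun h1 => ?_⟩
  have hle : sInf K ≤ Fintype.card V - 2 := Nat.sInf_le hmem
  have h2 : 2 ≤ Fintype.card V := by
    rw [← card_univ, ← card_pair hne]
    exact card_le_card (subset_univ _)
  rw [Nat.card_eq_fintype_card, Fintype.card_subtype_compl, Fintype.card_coe] at h1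
  omega

theorem vertexConnectivity_le_card {S : Finset V}
    (hS : ¬ (G.induce {v | v ∉ S}).Preconnected) : G.vertexConnectivity ≤ #S :=
  Nat.sInf_le ⟨S, rfl, Or.inl hS⟩

/-- If all the vertices in `S` are adjacent to all those outside and `S` holds at most half of the
vertices, then the algebraic connectivity is at least `#S`. -/
theorem card_le_algebraicConnectivity (h : 2 ≤ Fintype.card V) {S : Finset V}
    (hadj : ∀ i ∈ S, ∀ j ∉ S, G.Adj i j) (hcard : 2 * #S ≤ Fintype.card V) :
    (#S : ℝ) ≤ G.algebraicConnectivity h := by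
  classical
  refine G.le_algebraicConnectivity h fun x hx => ?_
  -- Discard all edges except those across the cut, each counted in both orders.
  have hpt : ∀ i j, (if i ∈ S then if j ∈ Sᶜ then (x i - x j) ^ 2 else 0 else 0) +
      (if j ∈ S then if i ∈ Sᶜ then (x j - x i) ^ 2 else 0 else 0) ≤
      if G.Adj i j then (x i - x j) ^ 2 else 0 := by
    intro i j
    by_cases hi : i ∈ S <;> by_cases hj : j ∈ S
    · simp only [hi, hj, mem_compl, not_true, if_true, if_false, add_zero]
      positivity
    · simp [hi, hj, hadj i hi j hj]
    · simp only [hi, hj, (hadj j hj i hi).symm, mem_compl, not_false_iff, if_true, if_false,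
        zero_add]
      exact le_of_eq (by ring)
    · simp only [hi, hj, if_false, add_zero]
      positivity
  have hE := Finset.sum_le_sum fun i (_ : i ∈ univ) =>
    Finset.sum_le_sum fun j (_ : j ∈ univ) => hpt i j
  simp only [Finset.sum_add_distrib] at hE
  rw [Finset.sum_comm (f := fun i j => if j ∈ S then if i ∈ Sᶜ then (x j - x i) ^ 2 else 0 else 0)]
    at hE
  have hcut : ∑ i, ∑ j, (if i ∈ S then if j ∈ Sᶜ then (x i - x j) ^ 2 else 0 else 0) =
      #Sᶜ * ∑ i ∈ S, x i ^ 2 + #S * ∑ j ∈ Sᶜ, x j ^ 2 -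
        2 * ((∑ i ∈ S, x i) * ∑ j ∈ Sᶜ, x j) := by
    have h1 : ∀ i, ∑ j, (if i ∈ S then if j ∈ Sᶜ then (x i - x j) ^ 2 else 0 else 0) =
        if i ∈ S then #Sᶜ * x i ^ 2 + ∑ j ∈ Sᶜ, x j ^ 2 - 2 * (x i * ∑ j ∈ Sᶜ, x j) else 0 := by
      intro i
      split_ifs
      · rw [Finset.sum_ite_mem, univ_inter]
        simp only [sub_sq, Finset.sum_add_distrib, Finset.sum_sub_distrib, Finset.sum_const,
          nsmul_eq_mul, ← Finset.mul_sum]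
        ring
      · simp
    simp only [h1]
    rw [Finset.sum_ite_mem, univ_inter]
    simp only [Finset.sum_add_distrib, Finset.sum_sub_distrib, Finset.sum_const, nsmul_eq_mul,
      ← Finset.mul_sum, ← Finset.sum_mul]
  rw [hcut] at hE
  have hσ := Finset.sum_add_sum_compl S x
  rw [hx] at hσ
  have hQ := Finset.sum_add_sum_compl S fun v => x v ^ 2
  have hc : (#S : ℝ) ≤ #Sᶜ := by
    have := S.card_add_card_compl
    exact_mod_cast (by omega : #S ≤ #Sᶜ)
  have hP : 0 ≤ ∑ i ∈ S, x i ^ 2 := by positivity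
  have hσ' : ∑ j ∈ Sᶜ, x j = -∑ i ∈ S, x i := by linarith
  rw [hσ'] at hE
  rw [← hQ]
  -- With sum zero the cut energy is `#Sᶜ * ∑_S x² + #S * ∑_Sᶜ x² + 2 * (∑_S x)²`.
  nlinarith [mul_le_mul_of_nonneg_right hc hP, sq_nonneg (∑ i ∈ S, x i)]

/-- A minimum cut `T` gives `μ ≤ #T = κ`, while the joined cut `S` gives `κ ≤ #S ≤ μ`. -/
theorem algebraicConnectivity_eq_vertexConnectivity (h : 2 ≤ Fintype.card V) {S : Finset V}
    (hadj : ∀ i ∈ S, ∀ j ∉ S, G.Adj i j) (hcard : 2 * #S ≤ Fintype.card V)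
    (hS : ¬ (G.induce {v | v ∉ S}).Preconnected) :
    G.algebraicConnectivity h = G.vertexConnectivity := by
  obtain ⟨u, w, hne, huw⟩ : ∃ u w, u ≠ w ∧ ¬ G.Adj u w := by
    by_contra! hcon
    refine hS fun u w => ?_
    by_cases huw : u = w
    · rw [huw]
    · refine Adj.reachable ?_
      simpa using hcon u w (Subtype.coe_injective.ne huw)
  obtain ⟨T, hTcard, hT⟩ := G.exists_card_eq_vertexConnectivity hne huw
  refine le_antisymm ?_ ?_
  · rw [← hTcard]
    exact (G.algebraicConnectivity_le_card_of_not_preconnected h hT).1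
  · refine le_trans ?_ (G.card_le_algebraicConnectivity h hadj hcard)
    exact_mod_cast G.vertexConnectivity_le_card hS

/-- In a graph that is not complete but connected, and whose complement is connected in the sense
that no proper nonempty set of vertices is completely joined to its complement, the algebraic
connectivity and the vertex connectivity differ. -/
theorem algebraicConnectivity_ne_vertexConnectivity (h : 2 ≤ Fintype.card V) {u w : V}
    (hne : u ≠ w) (huw : ¬ G.Adj u w) (hconn : G.Preconnected)
    (hjoin : ∀ S : Finset V, (∀ i ∈ S, ∀ j ∉ S, G.Adj i j) → S = ∅ ∨ S = univ) :
    G.algebraicConnectivity h ≠ G.vertexConnectivity := by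
  intro heq
  obtain ⟨S, hcard, hS⟩ := G.exists_card_eq_vertexConnectivity hne huw
  rw [← hcard] at heq
  rcases hjoin S ((G.algebraicConnectivity_le_card_of_not_preconnected h hS).2 heq) with rfl | rfl
  · refine hS fun a b => ?_
    obtain ⟨p⟩ := hconn a b
    exact ⟨p.induce _ (by simp)⟩
  · exact hS fun a => absurd (mem_univ _) a.2

/-- For a complete graph the algebraic connectivity is at least the number of vertices, which
exceeds the vertex connectivity. -/
theorem algebraicConnectivity_ne_vertexConnectivity_of_complete (h : 2 ≤ Fintype.card V)
    (hadj : ∀ i j, i ≠ j → G.Adj i j) : G.algebraicConnectivity h ≠ G.vertexConnectivity := by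
  classical
  have h1 : (Fintype.card V : ℝ) ≤ G.algebraicConnectivity h := by
    refine G.le_algebraicConnectivity h fun x hx => ?_
    have hpt : ∀ i j, (if G.Adj i j then (x i - x j) ^ 2 else 0) = (x i - x j) ^ 2 := by
      intro i j
      by_cases hij : i = j
      · simp [hij]
      · rw [if_pos (hadj i j hij)]
    simp only [hpt]
    -- For sum zero, the cross terms vanish and the energy is exactly `card V * ∑ x²`.
    simp only [sub_sq, Finset.sum_add_distrib, Finset.sum_sub_distrib, ← Finset.mul_sum, hx,
      Finset.sum_const, card_univ, nsmul_eq_mul, mul_zero, smul_zero]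
    linarith
  have h2 : G.vertexConnectivity ≤ Fintype.card V - 1 := by
    obtain ⟨v⟩ : Nonempty V := Fintype.card_pos_iff.1 (by omega)
    refine Nat.sInf_le ⟨univ.erase v, by rw [card_erase_of_mem (mem_univ v), card_univ],
      Or.inr ?_⟩
    simp [Nat.card_eq_fintype_card]
  intro heq
  rw [heq] at h1
  have h3 : Fintype.card V ≤ G.vertexConnectivity := by exact_mod_cast h1
  omega

end SimpleGraph

/-! ### Divisibility in the zero divisor graph of `ZMod n`. -/

namespace ZeroDivisor

/-- A positive natural number `k` below `n` with a multiple `k * l` divisible by `n`, where `n ∤ l`, is a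
zero divisor modulo `n`. -/
theorem exists_val_eq {n k l : ℕ} (hk0 : 0 < k) (hkn : k < n) (hl : ¬ n ∣ l) (hkl : n ∣ k * l) :
    ∃ x : ZeroDivisor (ZMod n), (x : ZMod n).val = k := by
  refine ⟨⟨(k : ZMod n), ?_, (l : ZMod n), ?_, ?_⟩, ZMod.val_natCast_of_lt hkn⟩
  · rw [Ne, ZMod.natCast_eq_zero_iff]
    exact Nat.not_dvd_of_pos_of_lt hk0 hkn
  · rwa [Ne, ZMod.natCast_eq_zero_iff]
  · rwa [← Nat.cast_mul, ZMod.natCast_eq_zero_iff]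

variable {n : ℕ} [NeZero n]

theorem mul_eq_zero_iff_dvd (x y : ZMod n) : x * y = 0 ↔ n ∣ x.val * y.val := by
  rw [← ZMod.natCast_eq_zero_iff, Nat.cast_mul, ZMod.natCast_zmod_val, ZMod.natCast_zmod_val]

theorem not_coprime_val (x : ZeroDivisor (ZMod n)) : ¬ (x : ZMod n).val.Coprime n := by
  intro hx
  obtain ⟨y, hy0, hy⟩ := x.2.2
  rw [mul_eq_zero_iff_dvd] at hy
  have h1 := hx.symm.dvd_of_dvd_mul_left hy
  rw [← ZMod.natCast_eq_zero_iff, ZMod.natCast_zmod_val] at h1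
  exact hy0 h1

theorem val_injective : Function.Injective fun x : ZeroDivisor (ZMod n) => (x : ZMod n).val :=
  (ZMod.val_injective n).comp Subtype.val_injective

theorem not_dvd_val (x : ZeroDivisor (ZMod n)) : ¬ n ∣ (x : ZMod n).val := by
  rw [← ZMod.natCast_eq_zero_iff, ZMod.natCast_zmod_val]
  exact x.2.1

theorem adj_iff {x y : ZeroDivisor (ZMod n)} :
    (zeroDivisorGraph (ZMod n)).Adj x y ↔ x ≠ y ∧ n ∣ (x : ZMod n).val * (y : ZMod n).val := by
  rw [← mul_eq_zero_iff_dvd]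
  rfl

theorem reachable_of_dvd {x y : ZeroDivisor (ZMod n)}
    (h : n ∣ (x : ZMod n).val * (y : ZMod n).val) :
    (zeroDivisorGraph (ZMod n)).Reachable x y := by
  by_cases hxy : x = y
  · rw [hxy]
  · exact (adj_iff.2 ⟨hxy, h⟩).reachable

/-- Let `n = p * m` with a prime `p < m` such that every zero divisor is a multiple of `m` or
of `p`, and such that no `p * k` with `0 < k < p` is a multiple of `m`. Then the multiples of `m`
form a minimum cut of the zero divisor graph, and they are adjacent to all other vertices. -/
theorem algebraicConnectivity_eq_of_eq_mul {p m : ℕ} (hp : p.Prime) (hn : n = p * m) (hpm : p < m)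
    (hmul : ∀ k, 0 < k → k < p → ¬ m ∣ p * k)
    (hcov : ∀ x : ℕ, ¬ x.Coprime n → m ∣ x ∨ p ∣ x) :
    ∃ h : 2 ≤ Fintype.card (ZeroDivisor (ZMod n)),
      (zeroDivisorGraph (ZMod n)).algebraicConnectivity h =
        ((zeroDivisorGraph (ZMod n)).vertexConnectivity : ℝ) := by
  classical
  have hp2 := hp.two_le
  have hm0 : 0 < m := by omega
  have vert : ∀ k, 0 < k → k < m → ∃ x : ZeroDivisor (ZMod n), (x : ZMod n).val = p * k := by
    intro k hk0 hkm
    refine exists_val_eq (l := m) (Nat.mul_pos hp.pos hk0) ?_ ?_ ?_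
    · rw [hn]
      exact Nat.mul_lt_mul_of_pos_left hkm hp.pos
    · exact Nat.not_dvd_of_pos_of_lt hm0 (by rw [hn]; nlinarith)
    · exact ⟨k, by rw [hn]; ring⟩
  have hmp : ¬ m ∣ p := by simpa using hmul 1 one_pos hp.one_lt
  -- The classes of `p` and `-p` will be separated by the cut; they differ because `m > 2`.
  obtain ⟨u, hu⟩ := vert 1 one_pos (by omega)
  obtain ⟨w, hw⟩ := vert (m - 1) (by omega) (by omega)
  rw [mul_one] at hu
  have huw : u ≠ w := by
    intro h
    rw [h, hw] at hu
    have := Nat.eq_of_mul_eq_mul_left hp.pos (hu.trans (mul_one p).symm)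
    omega
  have h2 : 2 ≤ Fintype.card (ZeroDivisor (ZMod n)) := by
    rw [← card_univ, ← card_pair huw]
    exact card_le_card (subset_univ _)
  refine ⟨h2, ?_⟩
  set S : Finset (ZeroDivisor (ZMod n)) := univ.filter fun x => m ∣ (x : ZMod n).val with hS
  have memS : ∀ x, x ∈ S ↔ m ∣ (x : ZMod n).val := fun x => by simp [hS]
  have huS : u ∉ S := by rwa [memS, hu]
  have hwS : w ∉ S := by
    rw [memS, hw]
    intro h
    refine hmp ((Nat.dvd_add_right h).1 ?_)
    have : p * (m - 1) + p = p * m := by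
      obtain ⟨m, rfl⟩ := Nat.exists_eq_add_of_lt hm0
      simp [mul_add]
    rw [this]
    exact Dvd.intro_left p rfl
  refine (zeroDivisorGraph (ZMod n)).algebraicConnectivity_eq_vertexConnectivity h2 (S := S)
    ?_ ?_ ?_
  · intro i hi j hj
    have hpj : p ∣ (j : ZMod n).val :=
      (hcov _ j.not_coprime_val).resolve_left fun h => hj ((memS j).2 h)
    refine adj_iff.2 ⟨fun h => hj (h ▸ hi), ?_⟩
    have := mul_dvd_mul hpj ((memS i).1 hi)
    rwa [← hn, mul_comm] at this
  -- The map `m * k ↦ p * k` injects `S` into its complement.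
  · have hf : ∀ x, ∃ y, x ∈ S → y ∈ Sᶜ ∧ (y : ZMod n).val * m = p * (x : ZMod n).val := by
      intro x
      by_cases hx : x ∈ S
      · obtain ⟨k, hk⟩ := (memS x).1 hx
        have hk0 : 0 < k := Nat.pos_of_ne_zero fun h => x.not_dvd_val (by simp [hk, h])
        have hkp : k < p := by
          have h1 := ZMod.val_lt (x : ZMod n)
          rw [hk] at h1
          have h1 : m * k < m * p := by rw [mul_comm m p, ← hn]; exact h1
          exact lt_of_mul_lt_mul_left h1 hm0.le
        obtain ⟨y, hy⟩ := vert k hk0 (by omega)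
        refine ⟨y, fun _ => ⟨?_, ?_⟩⟩
        · rw [mem_compl, memS, hy]
          exact hmul k hk0 hkp
        · rw [hy, hk]
          ring
      · exact ⟨x, fun h => absurd h hx⟩
    choose f hf using hf
    have h1 : #S ≤ #Sᶜ := by
      refine card_le_card_of_injOn f (fun x hx => (hf x hx).1) fun x hx y hy hxy => ?_
      have h3 := (hf x hx).2
      rw [hxy, (hf y hy).2] at h3
      exact val_injective (Nat.eq_of_mul_eq_mul_left hp.pos h3).symm
    have := S.card_add_card_compl
    omega
  -- The first step of any walk from `p` lands on a multiple of `m`, hence in `S`.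
  · intro hpre
    obtain ⟨q⟩ := hpre ⟨u, huS⟩ ⟨w, hwS⟩
    cases q with
    | nil => exact huw rfl
    | @cons _ v _ hv _ =>
      have hv' : (zeroDivisorGraph (ZMod n)).Adj u v := by simpa using hv
      have h3 := (adj_iff.1 hv').2
      rw [hu] at h3
      exact v.2 ((memS v).2 (Nat.dvd_of_mul_dvd_mul_left hp.pos (hn.symm.dvd.trans h3)))

/-- If `n` is not a prime power, then the zero divisor graph of `ℤ/n` is connected. -/
theorem preconnected_zeroDivisorGraph {p q : ℕ} (hp : p.Prime) (hq : q.Prime) (hpq : p ≠ q)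
    (hpn : p ∣ n) (hqn : q ∣ n) : (zeroDivisorGraph (ZMod n)).Preconnected := by
  have hn0 : 0 < n := Nat.pos_of_neZero n
  have vert : ∀ r : ℕ, r.Prime → r ∣ n →
      ∃ x : ZeroDivisor (ZMod n), (x : ZMod n).val = n / r := by
    intro r hr hrn
    refine exists_val_eq (l := r) (Nat.div_pos (Nat.le_of_dvd hn0 hrn) hr.pos)
      (Nat.div_lt_self hn0 hr.one_lt) (fun h => ?_) (by rw [Nat.div_mul_cancel hrn])
    exact hpq (((Nat.prime_dvd_prime_iff_eq hp hr).1 (hpn.trans h)).trans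
      ((Nat.prime_dvd_prime_iff_eq hq hr).1 (hqn.trans h)).symm)
  obtain ⟨c, hc⟩ := vert p hp hpn
  -- A multiple of a prime `r ∣ n` is annihilated by `n / r`, and `n / r` annihilates `n / p` when
  -- `r ≠ p`.
  have key : ∀ x, (zeroDivisorGraph (ZMod n)).Reachable x c := by
    intro x
    obtain ⟨r, hr, hrx, hrn⟩ := Nat.Prime.not_coprime_iff_dvd.1 x.not_coprime_val
    obtain ⟨y, hy⟩ := vert r hr hrn
    have hxy : (zeroDivisorGraph (ZMod n)).Reachable x y := by
      refine reachable_of_dvd ?_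
      rw [hy]
      have := mul_dvd_mul_right hrx (n / r)
      rwa [Nat.mul_div_cancel' hrn] at this
    refine hxy.trans ?_
    by_cases hrp : r = p
    · have : y = c := val_injective (by simp only [hy, hc, hrp])
      rw [this]
    · refine reachable_of_dvd ?_
      rw [hy, hc]
      obtain ⟨d, hd⟩ := ((Nat.coprime_primes hr hp).2 hrp).mul_dvd_of_dvd_of_dvd hrn hpn
      refine ⟨d, ?_⟩
      have h1 : n / r = p * d := Nat.div_eq_of_eq_mul_right hr.pos (by rw [hd]; ring)
      rw [h1, mul_right_comm, Nat.mul_div_cancel' hpn]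
  exact fun x y => (key x).trans (key y).symm

theorem algebraicConnectivity_ne_of_two_primes {p q : ℕ} (hp : p.Prime) (hq : q.Prime)
    (hpq : p ≠ q) (hpn : p ∣ n) (hqn : q ∣ n) (hn : n ≠ p * q)
    (h : 2 ≤ Fintype.card (ZeroDivisor (ZMod n))) :
    (zeroDivisorGraph (ZMod n)).algebraicConnectivity h ≠
      ((zeroDivisorGraph (ZMod n)).vertexConnectivity : ℝ) := by
  classical
  have hn0 : 0 < n := Nat.pos_of_neZero n
  have hcop := (Nat.coprime_primes hp hq).2 hpq
  have hdvd := hcop.mul_dvd_of_dvd_of_dvd hpn hqn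
  have hpqn : ¬ n ∣ p * q := fun h' => hn (Nat.dvd_antisymm h' hdvd)
  have hlt : p * q < n := lt_of_le_of_ne (Nat.le_of_dvd hn0 hdvd) (Ne.symm hn)
  have vert : ∀ r : ℕ, r.Prime → r ∣ n → r < n →
      ∃ x : ZeroDivisor (ZMod n), (x : ZMod n).val = r := fun r hr hrn hlt =>
    exists_val_eq (l := n / r) hr.pos hlt
      (Nat.not_dvd_of_pos_of_lt (Nat.div_pos hlt.le hr.pos) (Nat.div_lt_self hn0 hr.one_lt))
      (by rw [Nat.mul_div_cancel' hrn])
  obtain ⟨u, hu⟩ := vert p hp hpn ((Nat.le_mul_of_pos_right p hq.pos).trans_lt hlt)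
  obtain ⟨w, hw⟩ := vert q hq hqn ((Nat.le_mul_of_pos_left q hp.pos).trans_lt hlt)
  have huw : ¬ n ∣ (u : ZMod n).val * (w : ZMod n).val := by rwa [hu, hw]
  have hne : u ≠ w := fun h' => hpq (by rw [← hu, ← hw, h'])
  -- A vertex annihilated by both `p` and `q` would be annihilated by their gcd, which is 1.
  have key : ∀ x : ZeroDivisor (ZMod n), ¬ n ∣ (u : ZMod n).val * (x : ZMod n).val ∨
      ¬ n ∣ (w : ZMod n).val * (x : ZMod n).val := by
    intro x
    by_contra! hx
    rw [hu, hw] at hx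
    refine x.not_dvd_val ?_
    have h1 := Nat.dvd_gcd hx.1 hx.2
    rwa [Nat.gcd_mul_right, hcop, one_mul] at h1
  refine (zeroDivisorGraph (ZMod n)).algebraicConnectivity_ne_vertexConnectivity h hne
    (fun h' => huw (adj_iff.1 h').2) (preconnected_zeroDivisorGraph hp hq hpq hpn hqn)
    fun S hS => ?_
  -- Vertices with nonzero product cannot be split between `S` and its complement.
  have same : ∀ x y : ZeroDivisor (ZMod n), ¬ n ∣ (x : ZMod n).val * (y : ZMod n).val →
      (x ∈ S ↔ y ∈ S) := by
    intro x y hxy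
    constructor <;> intro hmem <;> by_contra hnot
    · exact hxy (adj_iff.1 (hS x hmem y hnot)).2
    · exact hxy (adj_iff.1 (hS y hmem x hnot).symm).2
  have all : ∀ x, u ∈ S ↔ x ∈ S := fun x =>
    (key x).elim (same u x) fun hx => (same u w huw).trans (same w x hx)
  by_cases huS : u ∈ S
  · exact Or.inr (eq_univ_iff_forall.2 fun x => (all x).1 huS)
  · exact Or.inl (eq_empty_iff_forall_notMem.2 fun x hx => huS ((all x).2 hx))

theorem adj_of_eq_prime_sq {p : ℕ} (hp : p.Prime) (hn : n = p ^ 2) {x y : ZeroDivisor (ZMod n)}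
    (hxy : x ≠ y) : (zeroDivisorGraph (ZMod n)).Adj x y := by
  have hdvd : ∀ z : ZeroDivisor (ZMod n), p ∣ (z : ZMod n).val := fun z => by
    by_contra hz
    refine z.not_coprime_val ?_
    have := ((Nat.Prime.coprime_iff_not_dvd hp).2 hz).symm.pow_right 2
    rwa [← hn] at this
  refine adj_iff.2 ⟨hxy, ?_⟩
  have := mul_dvd_mul (hdvd x) (hdvd y)
  rwa [← sq, ← hn] at this

end ZeroDivisor

/-! ### The classification of `n`. -/

theorem proposition5p6 (n : ℕ) [NeZero n] (hn : 4 ≤ n) (hcomp : ¬ n.Prime) :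
    (∃ h : 2 ≤ Fintype.card (ZeroDivisor (ZMod n)),
        (zeroDivisorGraph (ZMod n)).algebraicConnectivity h =
          ((zeroDivisorGraph (ZMod n)).vertexConnectivity : ℝ)) ↔
      ((∃ p q : ℕ, p.Prime ∧ q.Prime ∧ p ≠ q ∧ n = p * q) ∨
        ∃ p t : ℕ, p.Prime ∧ 3 ≤ t ∧ n = p ^ t) := by
  constructor
  · rintro ⟨h, heq⟩
    have hp : n.minFac.Prime := Nat.minFac_prime (by omega)
    set p := n.minFac with hpdef
    have hpn : p ∣ n := Nat.minFac_dvd n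
    by_cases huniq : ∀ {d : ℕ}, d.Prime → d ∣ n → d = p
    · right
      have hpow := Nat.eq_prime_pow_of_unique_prime_dvd (by omega) huniq
      set t := n.primeFactorsList.length
      refine ⟨p, t, hp, ?_, hpow⟩
      by_contra! ht
      -- The exponents 0 and 1 contradict `4 ≤ n` and compositeness; exponent 2 gives a complete
      -- graph.
      interval_cases t
      · rw [pow_zero] at hpow
        omega
      · rw [pow_one] at hpow
        exact hcomp (hpow ▸ hp)
      · exact (zeroDivisorGraph (ZMod n)).algebraicConnectivity_ne_vertexConnectivity_of_complete h
          (fun _ _ hxy => ZeroDivisor.adj_of_eq_prime_sq hp hpow hxy) heq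
    · left
      push Not at huniq
      obtain ⟨q, hq, hqn, hqp⟩ := huniq
      refine ⟨p, q, hp, hq, hqp.symm, ?_⟩
      by_contra hne
      exact ZeroDivisor.algebraicConnectivity_ne_of_two_primes hp hq hqp.symm hpn hqn hne h heq
  · rintro (⟨p, q, hp, hq, hpq, hnpq⟩ | ⟨p, t, hp, ht, hnpt⟩)
    · wlog hlt : p < q generalizing p q
      · exact this q p hq hp hpq.symm (by rw [hnpq, mul_comm])
          (lt_of_le_of_ne (not_lt.1 hlt) hpq.symm)
      refine ZeroDivisor.algebraicConnectivity_eq_of_eq_mul hp hnpq hlt ?_ ?_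
      · intro k hk0 hkp hdvd
        rcases hq.dvd_mul.1 hdvd with h | h
        · exact hpq ((Nat.prime_dvd_prime_iff_eq hq hp).1 h).symm
        · exact Nat.not_dvd_of_pos_of_lt hk0 (hkp.trans hlt) h
      · intro x hx
        obtain ⟨r, hr, hrx, hrn⟩ := Nat.Prime.not_coprime_iff_dvd.1 hx
        rw [hnpq] at hrn
        rcases hr.dvd_mul.1 hrn with h | h
        · exact Or.inr ((Nat.prime_dvd_prime_iff_eq hr hp).1 h ▸ hrx)
        · exact Or.inl ((Nat.prime_dvd_prime_iff_eq hr hq).1 h ▸ hrx)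
    · obtain ⟨s, rfl⟩ : ∃ s, t = s + 3 := ⟨t - 3, by omega⟩
      refine ZeroDivisor.algebraicConnectivity_eq_of_eq_mul (m := p ^ (s + 2)) hp
        (by rw [hnpt]; ring) ?_ ?_ ?_
      · calc p = p ^ 1 := (pow_one p).symm
          _ < p ^ (s + 2) := Nat.pow_lt_pow_right hp.one_lt (by omega)
      · intro k hk0 hkp hdvd
        have h1 : p * p ^ (s + 1) ∣ p * k := by
          rwa [← pow_succ']
        have h2 : p ∣ k := (dvd_pow_self p (by omega)).trans (Nat.dvd_of_mul_dvd_mul_left hp.pos h1)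
        exact Nat.not_dvd_of_pos_of_lt hk0 hkp h2
      · intro x hx
        obtain ⟨r, hr, hrx, hrn⟩ := Nat.Prime.not_coprime_iff_dvd.1 hx
        rw [hnpt] at hrn
        exact Or.inr ((Nat.prime_dvd_prime_iff_eq hr hp).1 (hr.dvd_of_dvd_pow hrn) ▸ hrx)
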